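/- For $E\subset\mathbb{Z}$ and $t\in\mathbb{R}$ write $\lfloor tE\rfloor=\{\lfloor tn\rfloor : n\in E\}$. Let $I$ run over the intervals $(M,N]=\{M+1,\dots,N\}$ of $\mathbb{Z}$, with length $|I|=N-M$, and let $$d^*(E)=\limsup_{|I|\to\infty}\frac{|E\cap I|}{|I|},\qquad D(E)=\limsup_{|I|\to\infty}\frac{\log|E\cap I|}{\log|I|}$$ be the upper Banach density and the counting dimension of $E$. **Theorem 1.2.** Let $k\ge 0$ be an integer and, for $i=0,\dots,k$, let $p_i\in\mathbb{Z}[x]$ be a polynomial of degree $d_i\ge 1$ and $E_i=\{p_i(n) : n\in\mathbb{Z}\}$. Then for Lebesgue almost every $\lambda=(\lambda_1,\dots,\lambda_k)\in\mathbb{R}^k$, $$D\big(E_0+\lfloor\lambda_1E_1\rfloor+\cdots+\lfloor\lambda_kE_k\rfloor\big)\ \ge\ \min\Big\{1,\ \frac1{d_0}+\frac1{d_1}+\cdots+\frac1{d_k}\Big\}.$$ If in addition $\sum_{i=0}^k 1/d_i>1$, then $d^*\big(E_0+\lfloor\lambda_1E_1\rfloor+\cdots+\lfloor\lambda_kE_k\rfloor\big)>0$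 for Lebesgue almost every $\lambda=(\lambda_1,\dots,\lambda_k)\in\mathbb{R}^k$. -/

import Mathlib

open scoped Pointwise

/-- The filter `|I| → ∞` on intervals of `ℤ`. The pair `I = (M, N)` stands for the interval
`(M, N] = {M + 1, …, N}`, whose length is `|I| = N - M`. Pairs with `N < M` are eventually
excluded by this filter. -/
noncomputable def intervalLengthAtTop : Filter (ℤ × ℤ) :=
  Filter.comap (fun I : ℤ × ℤ => I.2 - I.1) Filter.atTop

/-- `|E ∩ I|`, the number of elements of `E` in the interval `I = (M, N]`. -/
noncomputable def countIn (E : Set ℤ) (I : ℤ × ℤ) : ℕ :=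
  (E ∩ Set.Ioc I.1 I.2).ncard

/-- The upper Banach density `d*(E) = limsup_{|I| → ∞} |E ∩ I| / |I|`. The quotient lies in
`[0, 1]`, so that the real-valued `limsup` is the usual one. -/
noncomputable def upperBanachDensity (E : Set ℤ) : ℝ :=
  Filter.limsup (fun I : ℤ × ℤ => (countIn E I : ℝ) / ((I.2 - I.1 : ℤ) : ℝ)) intervalLengthAtTop

/-- The counting dimension `D(E) = limsup_{|I| → ∞} log |E ∩ I| / log |I|`. The quotient lies in
`[0, 1]` once `|I| ≥ 2`, so that the real-valued `limsup` is the usual one. Here `log 0 = 0`; if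
`E` is nonempty this does not affect the value, since there are arbitrarily long intervals that
meet `E`, and `D(∅) = 0`. -/
noncomputable def countingDimension (E : Set ℤ) : ℝ :=
  Filter.limsup (fun I : ℤ × ℤ => Real.log (countIn E I) / Real.log ((I.2 - I.1 : ℤ) : ℝ))
    intervalLengthAtTop

/-- `⌊t E⌋ = {⌊t n⌋ : n ∈ E}`. -/
def floorDilate (t : ℝ) (E : Set ℤ) : Set ℤ :=
  (fun n : ℤ => ⌊t * (n : ℝ)⌋) '' E

/-- The polynomial set `p(ℤ) = {p(n) : n ∈ ℤ}`. -/
def polySet (p : Polynomial ℤ) : Set ℤ :=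
  Set.range (fun n : ℤ => p.eval n)

/-- The arithmetic sum `E₀ + ⌊t₁ E₁⌋ + ⋯ + ⌊tₖ Eₖ⌋`; the `i`-th entry of `t`, counted from `0`,
is `t_{i+1}`, which dilates `E_{i+1}`. -/
def arithmeticSum {k : ℕ} (E : Fin (k + 1) → Set ℤ) (t : Fin k → ℝ) : Set ℤ :=
  E 0 + ∑ i : Fin k, floorDilate (t i) (E i.succ)

/-!
The proof is a second-moment argument based on transversality.

Suppose first that all degrees `d i` are at least two. At the scale `N = T ^ D`, `D = ∏ d i`, let
`A i` be the set of values of `p i` on a dyadic block of `N ^ (1 / d i)` integers; it is contained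
in an interval of length `≪ N` and its gaps are `≫ N ^ (1 - 1 / d i)`. The arithmetic sum contains
all values of `floorForm t` on `∏ A i`, a set of `P = N ^ s` points, `s = ∑ 1 / d i`.

For `x ≠ y`, the set of `t` in a fixed cube for which `x` and `y` give the same value lies in a
slab of measure `≪ 1 / ‖x - y‖` (`volume_floorForm_eq_le`). Hence the mean over `t` of the number
of colliding pairs is at most of the order of `P + ∑_{x ≠ y} 1 / ‖x - y‖`, and for products of
separated sets this sum is computed in `sum_inv_norm_sub_le`: it is `≪ P (1 + P / N)`. By Fatou's
lemma, for almost every `t` there are infinitely many `T` with `≪ P (1 + P / N)` collisions, and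
for these Cauchy–Schwarz yields `≫ min (P, N)` distinct values in an interval of length `≪ N`
(`ae_cube_frequently_countIn_ge`). This is the dimension bound `min (1, s)`, and it is positive
density if `s > 1`.

If some `d i` equals one, the mean number of collisions may carry a logarithm, but then the
arithmetic sum contains a translate of the floors of a nonconstant arithmetic progression as soon
as all `t j` are nonzero, and it has positive density (`exists_countIn_ge_of_linear`).
-/

open Filter Topology MeasureTheory

/-! ### Counting along symmetric intervals -/

theorem countIn_le_length (E : Set ℤ) {I : ℤ × ℤ} (h : I.1 ≤ I.2) :
    (countIn E I : ℝ) ≤ ((I.2 - I.1 : ℤ) : ℝ) := by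
  have h1 : countIn E I ≤ (I.2 - I.1).toNat := by
    unfold countIn
    calc (E ∩ Set.Ioc I.1 I.2).ncard ≤ (Set.Ioc I.1 I.2).ncard :=
          Set.ncard_le_ncard Set.inter_subset_right (Set.finite_Ioc _ _)
      _ = (I.2 - I.1).toNat := by
          rw [← Finset.coe_Ioc, Set.ncard_coe_finset, Int.card_Ioc]
  have h2 : (countIn E I : ℤ) ≤ I.2 - I.1 := by omega
  exact_mod_cast h2

theorem eventually_length_ge (m : ℤ) : ∀ᶠ I in intervalLengthAtTop, m ≤ I.2 - I.1 :=
  (tendsto_comap.eventually (eventually_ge_atTop m))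

theorem isBoundedUnder_density (E : Set ℤ) : intervalLengthAtTop.IsBoundedUnder (· ≤ ·)
    (fun I : ℤ × ℤ => (countIn E I : ℝ) / ((I.2 - I.1 : ℤ) : ℝ)) := by
  refine ⟨1, ?_⟩
  rw [eventually_map]
  filter_upwards [eventually_length_ge 0] with I hI
  exact div_le_one_of_le₀ (countIn_le_length E (by omega)) (by exact_mod_cast hI)

theorem isBoundedUnder_dimension (E : Set ℤ) : intervalLengthAtTop.IsBoundedUnder (· ≤ ·)
    (fun I : ℤ × ℤ => Real.log (countIn E I) / Real.log ((I.2 - I.1 : ℤ) : ℝ)) := by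
  refine ⟨1, ?_⟩
  rw [eventually_map]
  filter_upwards [eventually_length_ge 1] with I hI
  have hI' : (1 : ℝ) ≤ ((I.2 - I.1 : ℤ) : ℝ) := by exact_mod_cast hI
  refine div_le_one_of_le₀ ?_ (Real.log_nonneg hI')
  rcases Nat.eq_zero_or_pos (countIn E I) with h0 | h0
  · rw [h0]; simpa using Real.log_nonneg hI'
  · exact Real.log_le_log (by exact_mod_cast h0) (countIn_le_length E (by omega))

/-- The symmetric interval `(-C T ^ D, C T ^ D]`. -/
def symmInterval (C D T : ℕ) : ℤ × ℤ := (-(C * T ^ D : ℕ), (C * T ^ D : ℕ))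

theorem symmInterval_length (C D T : ℕ) :
    (((symmInterval C D T).2 - (symmInterval C D T).1 : ℤ) : ℝ) = 2 * C * (T : ℝ) ^ D := by
  simp [symmInterval]; ring

theorem tendsto_symmInterval {C D : ℕ} (hC : 0 < C) (hD : 0 < D) :
    Tendsto (symmInterval C D) atTop intervalLengthAtTop := by
  rw [intervalLengthAtTop, tendsto_comap_iff]
  refine tendsto_atTop_mono (f := fun T : ℕ => (T : ℤ)) (fun T => ?_)
    tendsto_natCast_atTop_atTop
  have h : T ≤ C * T ^ D :=
    (Nat.le_self_pow hD.ne' T).trans (Nat.le_mul_of_pos_left _ hC)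
  simp only [Function.comp, symmInterval]
  omega

/-- A linear lower bound for the counts along infinitely many of the intervals
`symmInterval C D T` already gives positive upper Banach density, since the `limsup` is over all intervals. -/
theorem upperBanachDensity_pos_of_frequently {S : Set ℤ} {c : ℝ} (hc : 0 < c) {C D : ℕ}
    (hC : 0 < C) (hD : 0 < D)
    (h : ∃ᶠ T : ℕ in atTop, c * (T : ℝ) ^ D ≤ countIn S (symmInterval C D T)) :
    0 < upperBanachDensity S := by
  have hC' : (0 : ℝ) < C := by exact_mod_cast hC
  refine lt_of_lt_of_le (b := c / (2 * C)) (by positivity) ?_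
  refine le_limsup_of_frequently_le ?_ (isBoundedUnder_density S)
  refine (tendsto_symmInterval hC hD).frequently ?_
  refine (h.and_eventually (eventually_gt_atTop 0)).mono ?_
  rintro T ⟨h, hT⟩
  have hT' : (0 : ℝ) < T := by exact_mod_cast hT
  rw [symmInterval_length, div_le_div_iff₀ (by positivity) (by positivity)]
  nlinarith

/-- If infinitely many of the intervals `symmInterval C D T`, of length comparable to `T ^ D`,
contain at least a constant times `T ^ q` points of `S`, then `S` has counting dimension at least
`q / D`. -/
theorem countingDimension_ge_of_frequently {S : Set ℤ} {c : ℝ} (hc : 0 < c) {C D q : ℕ}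
    (hC : 0 < C) (hD : 0 < D)
    (h : ∃ᶠ T : ℕ in atTop, c * (T : ℝ) ^ q ≤ countIn S (symmInterval C D T)) :
    (q / D : ℝ) ≤ countingDimension S := by
  have hC' : (0 : ℝ) < C := by exact_mod_cast hC
  have hD' : (0 : ℝ) < D := by exact_mod_cast hD
  have hlog : Tendsto (fun T : ℕ => Real.log T) atTop atTop :=
    Real.tendsto_log_atTop.comp tendsto_natCast_atTop_atTop
  have hlim : Tendsto (fun T : ℕ => (Real.log c / Real.log T + q) /
      (Real.log (2 * C) / Real.log T + D)) atTop (𝓝 (q / D)) := by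
    have h0 := ((hlog.const_div_atTop (Real.log c)).add_const (q : ℝ)).div
      ((hlog.const_div_atTop (Real.log (2 * C))).add_const (D : ℝ)) (by simpa using hD'.ne')
    rw [zero_add, zero_add] at h0
    exact h0
  refine le_of_forall_lt fun b hb => ?_
  obtain ⟨b', hbb', hb'⟩ := exists_between hb
  refine hbb'.trans_le ?_
  refine le_limsup_of_frequently_le ?_ (isBoundedUnder_dimension S)
  refine (tendsto_symmInterval hC hD).frequently ?_
  refine (h.and_eventually ((hlim.eventually (eventually_gt_nhds hb')).and
    (eventually_ge_atTop 2))).mono ?_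
  rintro T ⟨h, hT, hT2⟩
  have hT2' : (2 : ℝ) ≤ T := by exact_mod_cast hT2
  have hT' : (0 : ℝ) < T := by linarith
  have hl : 0 < Real.log T := Real.log_pos (by linarith)
  have hC1 : (1 : ℝ) ≤ C := by exact_mod_cast hC
  rw [symmInterval_length]
  refine hT.le.trans ?_
  have e1 : Real.log (2 * C * (T : ℝ) ^ D) = Real.log (2 * C) + D * Real.log T := by
    rw [Real.log_mul (by positivity) (by positivity), Real.log_pow]
  have e2 : Real.log (c * (T : ℝ) ^ q) = Real.log c + q * Real.log T := by
    rw [Real.log_mul (by positivity) (by positivity), Real.log_pow]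
  have e3 : (Real.log c / Real.log T + q) / (Real.log (2 * C) / Real.log T + D)
      = (Real.log c + q * Real.log T) / (Real.log (2 * C) + D * Real.log T) := by
    rw [← mul_div_mul_right _ _ hl.ne']
    congr 1 <;> field_simp
  rw [e3, e1, ← e2]
  have hden : 0 ≤ Real.log (2 * C) + D * Real.log T := by
    have := Real.log_nonneg (show (1 : ℝ) ≤ 2 * C by linarith)
    positivity
  gcongr

/-! ### Separation of polynomial values -/

/-- On `[L, 2L)` a polynomial of degree `d` expands distances by a factor `≫ L ^ (d - 1)`, by the
mean value theorem and the growth of the derivative, and its values are `≪ L ^ d`. -/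
theorem Polynomial.exists_separated_of_natDegree (p : Polynomial ℤ) (hp : 1 ≤ p.natDegree) :
    ∃ C : ℝ, 1 ≤ C ∧ ∀ᶠ L : ℕ in atTop, ∀ n ∈ Finset.Ico L (2 * L), ∀ m ∈ Finset.Ico L (2 * L),
      (L : ℝ) ^ (p.natDegree - 1) * |(n : ℝ) - m| ≤
        C * |((p.eval (n : ℤ) : ℤ) : ℝ) - p.eval (m : ℤ)| ∧
      |((p.eval (n : ℤ) : ℤ) : ℝ)| ≤ C * (L : ℝ) ^ p.natDegree := by
  set d := p.natDegree with hd
  set P : Polynomial ℝ := p.map (Int.castRingHom ℝ) with hP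
  have hPd : P.natDegree = d := by
    rw [hP, Polynomial.natDegree_map_eq_of_injective (Int.cast_injective)]
  have hP0 : P ≠ 0 := by rintro h; rw [h] at hPd; simp at hPd; omega
  have hder : P.derivative.degree = (d - 1 : ℕ) := by
    rw [Polynomial.degree_derivative (by omega), hPd]
  have h1 := Polynomial.isBigO_atTop_of_degree_le (Polynomial.X ^ (d - 1)) P.derivative
    (by rw [hder, Polynomial.degree_X_pow])
  have h2 := Polynomial.isBigO_atTop_of_degree_le P (Polynomial.X ^ d)
    (by rw [Polynomial.degree_X_pow, Polynomial.degree_eq_natDegree hP0, hPd])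
  obtain ⟨C₁, hC₁, h1⟩ := h1.exists_pos
  obtain ⟨C₂, hC₂, h2⟩ := h2.exists_pos
  have h1' := h1.bound
  have h2' := h2.bound
  simp only [Polynomial.eval_pow, Polynomial.eval_X, Real.norm_eq_abs] at h1' h2'
  obtain ⟨x₀, hx₀⟩ := eventually_atTop.1 (h1'.and h2')
  have heval : ∀ n : ℕ, ((p.eval (n : ℤ) : ℤ) : ℝ) = P.eval (n : ℝ) := by
    intro n
    simp [hP]
  refine ⟨C₁ + C₂ * 2 ^ d + 1, by nlinarith [show 0 < C₂ * 2 ^ d by positivity], ?_⟩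
  filter_upwards [tendsto_natCast_atTop_atTop.eventually (eventually_ge_atTop x₀)] with L hL
  intro n hn m hm
  rw [Finset.mem_Ico] at hn hm
  have hnL : (L : ℝ) ≤ n := by exact_mod_cast hn.1
  have hmL : (L : ℝ) ≤ m := by exact_mod_cast hm.1
  have hnL2 : (n : ℝ) ≤ 2 * L := by exact_mod_cast hn.2.le
  rw [heval, heval]
  constructor
  · have key : ∀ a b : ℝ, (L : ℝ) ≤ a → a < b →
        (L : ℝ) ^ (d - 1) * |a - b| ≤ C₁ * |P.eval a - P.eval b| := by
      intro a b ha hab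
      obtain ⟨ξ, hξ, hξ'⟩ := exists_deriv_eq_slope (fun x => P.eval x) hab
        P.continuous.continuousOn P.differentiable.differentiableOn
      rw [Polynomial.deriv, eq_div_iff (by linarith)] at hξ'
      have hb := (hx₀ ξ (by linarith [hξ.1])).1
      rw [abs_sub_comm (P.eval a), ← hξ', abs_mul, abs_sub_comm a b, ← mul_assoc]
      refine mul_le_mul_of_nonneg_right (le_trans ?_ hb) (abs_nonneg _)
      have hL0 : (0 : ℝ) ≤ L := Nat.cast_nonneg L
      rw [abs_of_nonneg (pow_nonneg (by linarith [hξ.1]) _)]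
      exact pow_le_pow_left₀ hL0 (by linarith [hξ.1]) _
    have hle : C₁ * |P.eval (n : ℝ) - P.eval (m : ℝ)| ≤
        (C₁ + C₂ * 2 ^ d + 1) * |P.eval (n : ℝ) - P.eval (m : ℝ)| := by
      gcongr
      linarith [show 0 < C₂ * 2 ^ d by positivity]
    refine le_trans ?_ hle
    rcases lt_trichotomy (n : ℝ) m with h | h | h
    · exact key _ _ hnL h
    · simp [h]
    · rw [abs_sub_comm, abs_sub_comm (P.eval _)]
      exact key _ _ hmL h
  · have hb := (hx₀ n (by linarith)).2
    refine hb.trans ?_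
    rw [abs_of_nonneg (by positivity)]
    calc C₂ * (n : ℝ) ^ d ≤ C₂ * (2 * L) ^ d := by gcongr
      _ = C₂ * 2 ^ d * (L : ℝ) ^ d := by rw [mul_pow]; ring
      _ ≤ _ := by gcongr; linarith

/-! ### Energy of products of separated sets -/

/-- A `δ`-separated set has `≪ 1 + z / δ` points within distance `z` of any given integer, because
`y ↦ ⌊(y - x) / δ⌋` is injective on it. -/
theorem card_filter_abs_sub_le {A : Finset ℤ} {δ : ℝ} (hδ : 0 < δ)
    (hA : ∀ x ∈ A, ∀ y ∈ A, x ≠ y → δ ≤ |(x : ℝ) - y|) (x : ℤ) {z : ℝ} (hz : 0 ≤ z) :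
    ((A.filter fun y : ℤ => |(x : ℝ) - y| ≤ z).card : ℝ) ≤ 2 * (1 + z / δ) := by
  have hcard : (A.filter fun y : ℤ => |(x : ℝ) - y| ≤ z).card ≤
      (Finset.Icc ⌊-(z / δ)⌋ ⌊z / δ⌋).card := by
    refine Finset.card_le_card_of_injOn (fun y : ℤ => ⌊((y : ℝ) - x) / δ⌋) ?_ ?_
    · intro y hy
      simp only [Finset.coe_filter, Set.mem_ofPred_eq] at hy
      have := abs_le.1 hy.2
      simp only [Finset.coe_Icc, Set.mem_Icc]
      constructor
      · refine Int.floor_le_floor ?_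
        rw [← neg_div]; gcongr; linarith
      · refine Int.floor_le_floor ?_
        gcongr; linarith
    · intro y hy y' hy' h
      simp only [Finset.coe_filter, Set.mem_ofPred_eq] at hy hy'
      by_contra hne
      have h1 := hA y hy.1 y' hy'.1 hne
      have h2 := Int.abs_sub_lt_one_of_floor_eq_floor h
      rw [← sub_div, abs_div, abs_of_pos hδ, div_lt_one hδ] at h2
      have : (y : ℝ) - x - (y' - x) = y - y' := by ring
      rw [this] at h2
      linarith
  have hle : ⌊-(z / δ)⌋ ≤ ⌊z / δ⌋ + 1 := by
    have : ⌊-(z / δ)⌋ ≤ ⌊z / δ⌋ := Int.floor_le_floor (by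
      have : 0 ≤ z / δ := by positivity
      linarith)
    omega
  have h3 : ((Finset.Icc ⌊-(z / δ)⌋ ⌊z / δ⌋).card : ℝ) = ⌊z / δ⌋ + 1 - ⌊-(z / δ)⌋ := by
    have := Int.card_Icc_of_le _ _ hle
    exact_mod_cast this
  calc _ ≤ ((Finset.Icc ⌊-(z / δ)⌋ ⌊z / δ⌋).card : ℝ) := by exact_mod_cast hcard
    _ ≤ _ := by
      rw [h3]
      linarith [Int.floor_le (z / δ), Int.lt_floor_add_one (-(z / δ))]

/-- The polynomial `u ↦ ∏ (1 + u bᵢ)` has nonnegative coefficients, so on `[0, 1]` it lies below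
its chord. -/
theorem prod_one_add_mul_le {ι : Type*} (s : Finset ι) {b : ι → ℝ} (hb : ∀ i ∈ s, 0 ≤ b i)
    {u : ℝ} (hu : 0 ≤ u) (hu1 : u ≤ 1) :
    ∏ i ∈ s, (1 + u * b i) ≤ 1 + u * (∏ i ∈ s, (1 + b i) - 1) := by
  classical
  induction s using Finset.induction_on with
  | empty => simp
  | insert a s ha ih =>
    rw [Finset.prod_insert ha, Finset.prod_insert ha]
    have hba := hb a (Finset.mem_insert_self _ _)
    have ih := ih fun i hi => hb i (Finset.mem_insert_of_mem hi)
    have hQ : 1 ≤ ∏ i ∈ s, (1 + b i) :=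
      Finset.one_le_prod fun i hi => by linarith [hb i (Finset.mem_insert_of_mem hi)]
    set Q := ∏ i ∈ s, (1 + b i)
    have h1 : (1 + u * b a) * ∏ i ∈ s, (1 + u * b i) ≤ (1 + u * b a) * (1 + u * (Q - 1)) := by
      gcongr
    have h2 : 0 ≤ u * b a * (Q - 1) * (1 - u) := by
      have : 0 ≤ Q - 1 := by linarith
      have : 0 ≤ 1 - u := by linarith
      positivity
    nlinarith

theorem sum_biUnion_le_sum {α β : Type*} [DecidableEq β] (s : Finset α) (F : α → Finset β)
    {g : β → ℝ} (hg : ∀ b, 0 ≤ g b) :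
    ∑ b ∈ s.biUnion F, g b ≤ ∑ a ∈ s, ∑ b ∈ F a, g b := by
  classical
  induction s using Finset.induction_on with
  | empty => simp
  | insert a s ha ih =>
    rw [Finset.biUnion_insert, Finset.sum_insert ha]
    have h := Finset.sum_union_inter (s₁ := F a) (s₂ := s.biUnion F) (f := g)
    have h' : 0 ≤ ∑ b ∈ F a ∩ s.biUnion F, g b := Finset.sum_nonneg fun b _ => hg b
    linarith

/-- Energy estimate for a product of separated sets, `‖·‖` being the sup norm. The points `y ≠ x`
are sorted by a coordinate `i` where `|x i - y i|` is maximal and by the value `v = y i`; with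
`z = |x i - v|` there are at most `∏_{j ≠ i} 2 (1 + z / δ j)` such points, and the chord bound
`prod_one_add_mul_le` at `u = z / B` separates the contribution `1 / z` of a single varying
coordinate from that of several. -/
theorem sum_inv_norm_sub_le {ι : Type*} [Fintype ι] [DecidableEq ι] {A : ι → Finset ℤ}
    {δ : ι → ℝ} (hδ : ∀ i, 0 < δ i)
    (hA : ∀ i, ∀ x ∈ A i, ∀ y ∈ A i, x ≠ y → δ i ≤ |(x : ℝ) - y|)
    {B : ℝ} (hB : 0 < B) (hAB : ∀ i, ∀ x ∈ A i, ∀ y ∈ A i, |(x : ℝ) - y| ≤ B)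
    {x : ι → ℤ} (hx : x ∈ Fintype.piFinset A) :
    ∑ y ∈ (Fintype.piFinset A).erase x, ‖x - y‖⁻¹ ≤
      ∑ i, (A i).card * (2 ^ Fintype.card ι *
        ((δ i)⁻¹ + B⁻¹ * ∏ j ∈ Finset.univ.erase i, (1 + B / δ j))) := by
  have hxA : ∀ i, x i ∈ A i := Fintype.mem_piFinset.1 hx
  set F : ι → ℤ → Finset (ι → ℤ) := fun i v => Fintype.piFinset fun j =>
    if j = i then {v} else (A j).filter fun u : ℤ => |(x j : ℝ) - u| ≤ |(x i : ℝ) - v| with hF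
  have hcover : (Fintype.piFinset A).erase x ⊆
      Finset.univ.biUnion fun i => ((A i).erase (x i)).biUnion (F i) := by
    intro y hy
    rw [Finset.mem_erase, Fintype.mem_piFinset] at hy
    obtain ⟨hne, hy⟩ := hy
    obtain ⟨i₀, hi₀⟩ : ∃ i, y i ≠ x i := by
      by_contra! h
      exact hne (funext h)
    have : Nonempty ι := ⟨i₀⟩
    obtain ⟨i, hi⟩ := Finite.exists_max fun i => |(x i : ℝ) - y i|
    have hyi : y i ≠ x i := by
      intro h
      have h1 := hi i₀
      rw [h, sub_self, abs_zero] at h1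
      have h2 := abs_nonpos_iff.1 h1
      exact hi₀ (by exact_mod_cast (sub_eq_zero.1 h2).symm)
    simp only [Finset.mem_biUnion, Finset.mem_univ, true_and, Finset.mem_erase]
    refine ⟨i, y i, ⟨hyi, hy i⟩, ?_⟩
    rw [hF, Fintype.mem_piFinset]
    intro j
    split_ifs with hj
    · simp [hj]
    · exact Finset.mem_filter.2 ⟨hy j, hi j⟩
  have hcard : ∀ i v, ((F i v).card : ℝ) ≤
      ∏ j ∈ Finset.univ.erase i, (2 * (1 + |(x i : ℝ) - v| / δ j)) := by
    intro i v
    rw [hF, Fintype.card_piFinset, ← Finset.mul_prod_erase _ _ (Finset.mem_univ i)]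
    simp only [if_true, Finset.card_singleton, one_mul, Nat.cast_prod]
    refine Finset.prod_le_prod (fun _ _ => by positivity) fun j hj => ?_
    rw [if_neg (Finset.ne_of_mem_erase hj)]
    exact card_filter_abs_sub_le (hδ j) (hA j) _ (abs_nonneg _)
  calc ∑ y ∈ (Fintype.piFinset A).erase x, ‖x - y‖⁻¹
      ≤ ∑ y ∈ Finset.univ.biUnion fun i => ((A i).erase (x i)).biUnion (F i), ‖x - y‖⁻¹ :=
        Finset.sum_le_sum_of_subset_of_nonneg hcover fun _ _ _ => by positivity
    _ ≤ ∑ i, ∑ v ∈ (A i).erase (x i), ∑ y ∈ F i v, ‖x - y‖⁻¹ := by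
        refine (sum_biUnion_le_sum _ _ fun _ => by positivity).trans ?_
        exact Finset.sum_le_sum fun i _ => sum_biUnion_le_sum _ _ fun _ => by positivity
    _ ≤ ∑ i, ∑ v ∈ (A i).erase (x i), (2 ^ Fintype.card ι *
        ((δ i)⁻¹ + B⁻¹ * ∏ j ∈ Finset.univ.erase i, (1 + B / δ j))) := by
        refine Finset.sum_le_sum fun i _ => Finset.sum_le_sum fun v hv => ?_
        obtain ⟨hvx, hv⟩ := Finset.mem_erase.1 hv
        set z := |(x i : ℝ) - v| with hz
        have hzδ : δ i ≤ z := hA i _ (hxA i) _ hv hvx.symm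
        have hz0 : 0 < z := (hδ i).trans_le hzδ
        have hzB : z ≤ B := hAB i _ (hxA i) _ hv
        have hQ0 : 0 ≤ ∏ j ∈ Finset.univ.erase i, (1 + B / δ j) :=
          Finset.prod_nonneg fun j _ => by have := hδ j; positivity
        have h1 : ∑ y ∈ F i v, ‖x - y‖⁻¹ ≤ (F i v).card • z⁻¹ := by
          refine Finset.sum_le_card_nsmul _ _ _ fun y hy => ?_
          have hyi : y i = v := by
            have := Fintype.mem_piFinset.1 hy i
            simpa using this
          refine inv_anti₀ hz0 ?_
          have := norm_le_pi_norm (x - y) i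
          rw [Pi.sub_apply, hyi, Int.norm_eq_abs] at this
          push_cast at this
          exact this
        have h2 : ∏ j ∈ Finset.univ.erase i, (1 + z / δ j) ≤
            1 + z / B * ∏ j ∈ Finset.univ.erase i, (1 + B / δ j) := by
          have h := prod_one_add_mul_le (Finset.univ.erase i) (b := fun j => B / δ j)
            (fun j _ => by have := hδ j; positivity) (u := z / B) (by positivity)
            (div_le_one_of_le₀ hzB hB.le)
          have h' : ∀ j, z / B * (B / δ j) = z / δ j := fun j => by field_simp
          simp only [h'] at h
          refine h.trans ?_
          have : 0 ≤ z / B := by positivity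
          nlinarith
        have h3 : ((F i v).card : ℝ) ≤ 2 ^ Fintype.card ι *
            (1 + z / B * ∏ j ∈ Finset.univ.erase i, (1 + B / δ j)) := by
          refine (hcard i v).trans ?_
          rw [Finset.prod_mul_distrib, Finset.prod_const]
          refine mul_le_mul ?_ h2 (Finset.prod_nonneg fun j _ => by have := hδ j; positivity)
            (by positivity)
          exact pow_le_pow_right₀ (by norm_num) (by
            rw [← Finset.card_univ]; exact Finset.card_le_card (Finset.erase_subset _ _))
        rw [nsmul_eq_mul] at h1
        refine h1.trans ?_
        calc ((F i v).card : ℝ) * z⁻¹ ≤ (2 ^ Fintype.card ι *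
            (1 + z / B * ∏ j ∈ Finset.univ.erase i, (1 + B / δ j))) * z⁻¹ := by gcongr
          _ = 2 ^ Fintype.card ι *
            (z⁻¹ + B⁻¹ * ∏ j ∈ Finset.univ.erase i, (1 + B / δ j)) := by field_simp
          _ ≤ _ := by
            have := hδ i
            gcongr
    _ ≤ _ := by
        refine Finset.sum_le_sum fun i _ => ?_
        rw [Finset.sum_const, nsmul_eq_mul]
        have hQ0 : 0 ≤ ∏ j ∈ Finset.univ.erase i, (1 + B / δ j) :=
          Finset.prod_nonneg fun j _ => by have := hδ j; positivity
        have := hδ i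
        gcongr
        exact Finset.erase_subset _ _

/-! ### Slabs and transversality -/

/-- The closed cube `[-R, R]^k`. -/
def cube (k : ℕ) (R : ℝ) : Set (Fin k → ℝ) := Set.univ.pi fun _ => Set.Icc (-R) R

theorem measurableSet_cube (k : ℕ) (R : ℝ) : MeasurableSet (cube k R) :=
  MeasurableSet.univ_pi fun _ => measurableSet_Icc

theorem volume_cube (k : ℕ) (R : ℝ) : volume (cube k R) = ENNReal.ofReal (2 * R) ^ k := by
  rw [cube, volume_pi_pi]
  simp [Real.volume_Icc, two_mul]

/-- A slab of width `≍ w / |a i|` in the direction of the `i`-th coordinate meets the cube in a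
set of proportional volume, by Fubini over the other coordinates. -/
theorem volume_cube_inter_slab_le {n : ℕ} (R : ℝ) (a : Fin (n + 1) → ℝ) (b w : ℝ)
    {i : Fin (n + 1)} (hi : a i ≠ 0) :
    volume (cube (n + 1) R ∩ {t | |b + ∑ j, t j * a j| ≤ w}) ≤
      ENNReal.ofReal (2 * (w / |a i|)) * ENNReal.ofReal (2 * R) ^ n := by
  set S := cube (n + 1) R ∩ {t | |b + ∑ j, t j * a j| ≤ w} with hS
  have hSm : MeasurableSet S := by
    refine (measurableSet_cube _ _).inter (measurableSet_le ?_ measurable_const)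
    fun_prop
  have hmp := (volume_preserving_piFinSuccAbove (fun _ : Fin (n + 1) => ℝ) i).symm
  rw [← hmp.measure_preimage hSm.nullMeasurableSet, Measure.volume_eq_prod,
    Measure.prod_apply_symm (hmp.measurable hSm)]
  calc _ ≤ ∫⁻ y : Fin n → ℝ, (cube n R).indicator
          (fun _ => ENNReal.ofReal (2 * (w / |a i|))) y := by
        refine lintegral_mono fun y => ?_
        by_cases hy : y ∈ cube n R
        · rw [Set.indicator_of_mem hy, ← Real.volume_closedBall
            (-(b + ∑ j, y j * a (i.succAbove j)) / a i)]
          refine measure_mono fun s hs => ?_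
          have hs2 := hs.2
          simp only [MeasurableEquiv.piFinSuccAbove_symm_apply, Fin.insertNthEquiv_apply,
            Set.mem_ofPred_eq, Fin.sum_univ_succAbove _ i, Fin.insertNth_apply_same,
            Fin.insertNth_apply_succAbove] at hs2
          rw [Metric.mem_closedBall, Real.dist_eq, le_div_iff₀ (abs_pos.2 hi), ← abs_mul]
          refine le_trans (le_of_eq ?_) hs2
          congr 1
          field_simp
          ring
        · rw [Set.indicator_of_notMem hy, nonpos_iff_eq_zero]
          convert measure_empty (μ := (volume : Measure ℝ))
          rw [Set.eq_empty_iff_forall_notMem]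
          intro s hs
          refine hy fun j _ => ?_
          have := hs.1 (i.succAbove j) trivial
          simpa [MeasurableEquiv.piFinSuccAbove_symm_apply] using this
    _ = _ := by
        rw [lintegral_indicator (measurableSet_cube _ _), setLIntegral_const, volume_cube]

/-- The form `x₀ + ∑ ⌊tᵢ xᵢ₊₁⌋`, whose values on a product set make up the arithmetic sum. -/
noncomputable def floorForm {k : ℕ} (t : Fin k → ℝ) (x : Fin (k + 1) → ℤ) : ℤ :=
  x 0 + ∑ i : Fin k, ⌊t i * (x i.succ : ℝ)⌋

theorem measurable_floorForm {k : ℕ} (x : Fin (k + 1) → ℤ) :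
    Measurable fun t : Fin k → ℝ => floorForm t x := by
  unfold floorForm
  fun_prop

theorem measurableSet_floorForm_eq {k : ℕ} (x y : Fin (k + 1) → ℤ) :
    MeasurableSet {t : Fin k → ℝ | floorForm t x = floorForm t y} :=
  measurableSet_eq_fun (measurable_floorForm x) (measurable_floorForm y)

/-- A collision of `floorForm t` at `x` and `y` forces the linear form with coefficients `x - y`
to be bounded by `k`, as each floor costs less than one. -/
theorem abs_linear_le_of_floorForm_eq {k : ℕ} {t : Fin k → ℝ} {x y : Fin (k + 1) → ℤ}
    (h : floorForm t x = floorForm t y) :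
    |((x 0 - y 0 : ℤ) : ℝ) + ∑ i, t i * ((x i.succ - y i.succ : ℤ) : ℝ)| ≤ k := by
  have h' : ((x 0 : ℤ) : ℝ) + ∑ i : Fin k, (⌊t i * (x i.succ : ℝ)⌋ : ℝ) =
      ((y 0 : ℤ) : ℝ) + ∑ i : Fin k, (⌊t i * (y i.succ : ℝ)⌋ : ℝ) := by
    unfold floorForm at h
    exact_mod_cast h
  have e : ((x 0 - y 0 : ℤ) : ℝ) + ∑ i, t i * ((x i.succ - y i.succ : ℤ) : ℝ) =
      ∑ i, (Int.fract (t i * (x i.succ : ℝ)) - Int.fract (t i * (y i.succ : ℝ))) := by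
    simp only [Int.fract, Int.cast_sub, mul_sub, Finset.sum_sub_distrib]
    linarith
  rw [e]
  refine (Finset.abs_sum_le_sum_abs _ _).trans ?_
  calc _ ≤ ∑ _i : Fin k, (1 : ℝ) := by
        refine Finset.sum_le_sum fun i _ => abs_le.2 ?_
        have h1 := Int.fract_nonneg (t i * (x i.succ : ℝ))
        have h2 := Int.fract_nonneg (t i * (y i.succ : ℝ))
        have h3 := Int.fract_lt_one (t i * (x i.succ : ℝ))
        have h4 := Int.fract_lt_one (t i * (y i.succ : ℝ))
        constructor <;> linarith
    _ = k := by simp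

/-- Transversality: for distinct `x`, `y`, the parameters in a fixed cube for which `floorForm`
takes the same value at `x` and `y` have measure `≪ 1 / ‖x - y‖`. If the coordinates of `x - y`
other than the `0`-th vanish, there is no collision at all; otherwise a collision bounds the
`0`-th one in terms of the others, so that the slab estimate in the largest of these is enough. -/
theorem volume_floorForm_eq_le (k : ℕ) {R : ℝ} (hR : 0 < R) :
    ∃ K : ℝ, 0 < K ∧ ∀ x y : Fin (k + 1) → ℤ, x ≠ y →
      volume (cube k R ∩ {t | floorForm t x = floorForm t y}) ≤
        ENNReal.ofReal (K * ‖x - y‖⁻¹) := by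
  refine ⟨2 * k * (2 * R) ^ (k - 1) * (1 + k + k * R) + 1, by positivity, fun x y hxy => ?_⟩
  rcases Set.eq_empty_or_nonempty (cube k R ∩ {t | floorForm t x = floorForm t y}) with h | h
  · simp [h]
  obtain ⟨t, htc, ht⟩ := h
  cases k with
  | zero =>
    exfalso
    refine hxy (funext fun i => ?_)
    fin_cases i
    simpa [floorForm] using ht
  | succ n =>
    obtain ⟨i, hi⟩ := Finite.exists_max fun i : Fin (n + 1) => |((x i.succ - y i.succ : ℤ) : ℝ)|
    set m := |((x i.succ - y i.succ : ℤ) : ℝ)| with hm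
    have hlin := abs_linear_le_of_floorForm_eq ht
    have hm0 : x i.succ - y i.succ ≠ 0 := by
      intro h0
      rw [h0] at hm
      simp only [Int.cast_zero, abs_zero] at hm
      have hs : ∀ j : Fin (n + 1), x j.succ = y j.succ := fun j => by
        have := hi j
        rw [hm, abs_nonpos_iff] at this
        have : x j.succ - y j.succ = 0 := by exact_mod_cast this
        omega
      have ht' : floorForm t x = floorForm t y := ht
      simp only [floorForm, hs] at ht'
      refine hxy (funext fun j => ?_)
      refine Fin.cases ?_ hs j
      omega
    have hm1 : 1 ≤ m := by
      rw [hm]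
      exact_mod_cast Int.one_le_abs hm0
    have hmpos : 0 < m := by linarith
    have hsum : |∑ j, t j * ((x j.succ - y j.succ : ℤ) : ℝ)| ≤ ((n + 1 : ℕ) : ℝ) * (R * m) := by
      refine (Finset.abs_sum_le_sum_abs _ _).trans ?_
      calc _ ≤ ∑ _j : Fin (n + 1), R * m := by
            refine Finset.sum_le_sum fun j _ => ?_
            rw [abs_mul]
            exact mul_le_mul (abs_le.2 (htc j trivial)) (hi j) (abs_nonneg _) hR.le
        _ = _ := by simp
    have hnorm : ‖x - y‖ ≤ (1 + (n + 1 : ℕ) + (n + 1 : ℕ) * R) * m := by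
      refine (pi_norm_le_iff_of_nonneg (by positivity)).2 fun j => ?_
      rw [Pi.sub_apply, Int.norm_eq_abs]
      refine Fin.cases ?_ (fun j => ?_) j
      · have h1 := abs_sub_abs_le_abs_add ((x 0 - y 0 : ℤ) : ℝ)
          (∑ j, t j * ((x j.succ - y j.succ : ℤ) : ℝ))
        have : ((n + 1 : ℕ) : ℝ) * 1 ≤ ((n + 1 : ℕ) : ℝ) * m := by gcongr
        linarith
      · have := hi j
        have h2 : 0 ≤ (((n + 1 : ℕ) : ℝ) + (n + 1 : ℕ) * R) * m := by positivity
        linarith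
    have hnorm0 : 0 < ‖x - y‖ := norm_pos_iff.2 (sub_ne_zero.2 hxy)
    calc _ ≤ volume (cube (n + 1) R ∩ {t | |((x 0 - y 0 : ℤ) : ℝ) +
              ∑ j, t j * ((x j.succ - y j.succ : ℤ) : ℝ)| ≤ (n + 1 : ℕ)}) :=
          measure_mono fun s hs => ⟨hs.1, abs_linear_le_of_floorForm_eq hs.2⟩
      _ ≤ _ := volume_cube_inter_slab_le R (fun j => ((x j.succ - y j.succ : ℤ) : ℝ)) _ _
          (i := i) (by exact_mod_cast hm0)
      _ = ENNReal.ofReal (2 * ((n + 1 : ℕ) / m) * (2 * R) ^ n) := by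
          rw [← ENNReal.ofReal_pow (by positivity), ← ENNReal.ofReal_mul (by positivity)]
      _ ≤ _ := by
          refine ENNReal.ofReal_le_ofReal ?_
          rw [← div_eq_mul_inv, le_div_iff₀ hnorm0]
          calc _ ≤ 2 * ((n + 1 : ℕ) / m) * (2 * R) ^ n *
                ((1 + (n + 1 : ℕ) + (n + 1 : ℕ) * R) * m) := by gcongr
            _ = 2 * (n + 1 : ℕ) * (2 * R) ^ n * (1 + (n + 1 : ℕ) + (n + 1 : ℕ) * R) := by
                field_simp
            _ ≤ _ := by simp

/-! ### Collisions -/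

/-- Cauchy–Schwarz on the fibres of `f`. -/
theorem card_sq_le_card_image_mul_energy {α β : Type*} [DecidableEq β] (s : Finset α)
    (f : α → β) :
    s.card ^ 2 ≤ (s.image f).card * ((s ×ˢ s).filter fun q => f q.1 = f q.2).card := by
  classical
  have h1 : s.card = ∑ b ∈ s.image f, (s.filter fun a => f a = b).card :=
    Finset.card_eq_sum_card_image f s
  have h2 : ((s ×ˢ s).filter fun q => f q.1 = f q.2).card =
      ∑ b ∈ s.image f, (s.filter fun a => f a = b).card ^ 2 := by
    rw [Finset.card_eq_sum_card_fiberwise (f := fun q : α × α => f q.1) (t := s.image f)]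
    · refine Finset.sum_congr rfl fun b _ => ?_
      rw [sq, ← Finset.card_product]
      congr 1
      ext q
      simp only [Finset.mem_filter, Finset.mem_product]
      constructor
      · rintro ⟨⟨⟨h1, h2⟩, h3⟩, h4⟩
        exact ⟨⟨h1, h4⟩, h2, h3 ▸ h4⟩
      · rintro ⟨⟨h1, h4⟩, h2, h3⟩
        exact ⟨⟨⟨h1, h2⟩, h4.trans h3.symm⟩, h4⟩
    · intro q hq
      simp only [Finset.coe_filter, Finset.mem_product, Set.mem_ofPred_eq] at hq
      exact Finset.mem_coe.2 (Finset.mem_image_of_mem _ hq.1.1)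
  rw [h1, h2]
  exact sq_sum_le_card_mul_sum_sq

/-- The number of ordered pairs of points of `X`, the diagonal included, at which
the form `floorForm t` agrees. -/
noncomputable def collisions {k : ℕ} (X : Finset (Fin (k + 1) → ℤ)) (t : Fin k → ℝ) : ℕ :=
  ((X ×ˢ X).filter fun q => floorForm t q.1 = floorForm t q.2).card

theorem collisions_eq_sum {k : ℕ} (X : Finset (Fin (k + 1) → ℤ)) (t : Fin k → ℝ) :
    (collisions X t : ENNReal) = ∑ x ∈ X, ∑ y ∈ X,
      Set.indicator {t : Fin k → ℝ | floorForm t x = floorForm t y} 1 t := by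
  rw [collisions, Finset.card_filter, Finset.sum_product]
  push_cast
  refine Finset.sum_congr rfl fun x _ => Finset.sum_congr rfl fun y _ => ?_
  simp [Set.indicator_apply]

theorem measurable_collisions {k : ℕ} (X : Finset (Fin (k + 1) → ℤ)) :
    Measurable fun t => (collisions X t : ENNReal) := by
  simp only [collisions_eq_sum]
  refine Finset.measurable_sum _ fun x _ => Finset.measurable_sum _ fun y _ => ?_
  exact measurable_one.indicator (measurableSet_floorForm_eq x y)

/-- The mean number of collisions over a cube: diagonal pairs contribute `≪ |X|`, and off-diagonal
ones are controlled by transversality. -/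
theorem lintegral_collisions_le (k : ℕ) {R : ℝ} (hR : 0 < R) :
    ∃ K : ℝ, 0 < K ∧ ∀ (X : Finset (Fin (k + 1) → ℤ)) (W : ℝ), 0 ≤ W →
      (∀ x ∈ X, ∑ y ∈ X.erase x, ‖x - y‖⁻¹ ≤ W) →
      ∫⁻ t in cube k R, (collisions X t : ENNReal) ≤ ENNReal.ofReal (K * X.card * (1 + W)) := by
  obtain ⟨K, hK, hcol⟩ := volume_floorForm_eq_le k hR
  refine ⟨(2 * R) ^ k + K, by positivity, fun X W hW hX => ?_⟩
  simp only [collisions_eq_sum]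
  rw [lintegral_finsetSum _ fun x _ => Finset.measurable_sum _ fun y _ =>
    measurable_one.indicator (measurableSet_floorForm_eq x y)]
  have hx : ∀ x ∈ X, ∫⁻ t in cube k R, ∑ y ∈ X,
      Set.indicator {t : Fin k → ℝ | floorForm t x = floorForm t y} 1 t ≤
        ENNReal.ofReal (((2 * R) ^ k + K) * (1 + W)) := by
    intro x hx
    rw [lintegral_finsetSum _ fun y _ =>
      measurable_one.indicator (measurableSet_floorForm_eq x y)]
    simp only [lintegral_indicator_one (measurableSet_floorForm_eq _ _),
      Measure.restrict_apply (measurableSet_floorForm_eq _ _)]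
    rw [← Finset.add_sum_erase _ _ hx]
    calc _ ≤ ENNReal.ofReal ((2 * R) ^ k) +
          ∑ y ∈ X.erase x, ENNReal.ofReal (K * ‖x - y‖⁻¹) := by
          refine add_le_add ?_ (Finset.sum_le_sum fun y hy => ?_)
          · refine (measure_mono Set.inter_subset_right).trans_eq ?_
            rw [volume_cube, ENNReal.ofReal_pow (by positivity)]
          · rw [Set.inter_comm]
            exact hcol x y (Finset.ne_of_mem_erase hy).symm
      _ = ENNReal.ofReal ((2 * R) ^ k + K * ∑ y ∈ X.erase x, ‖x - y‖⁻¹) := by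
          rw [← ENNReal.ofReal_sum_of_nonneg fun _ _ => by positivity, ← Finset.mul_sum,
            ENNReal.ofReal_add (by positivity)
              (mul_nonneg hK.le (Finset.sum_nonneg fun _ _ => by positivity))]
      _ ≤ _ := by
          refine ENNReal.ofReal_le_ofReal ?_
          have h1 := mul_le_mul_of_nonneg_left (hX x hx) hK.le
          have h2 : 0 ≤ (2 * R) ^ k * W := by positivity
          nlinarith
  refine (Finset.sum_le_card_nsmul _ _ _ hx).trans_eq ?_
  rw [nsmul_eq_mul, ← ENNReal.ofReal_natCast, ← ENNReal.ofReal_mul (by positivity)]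
  congr 1
  ring

/-! ### Values of the form and the arithmetic sum -/

theorem floorForm_eq_sum {k : ℕ} (t : Fin k → ℝ) (x : Fin (k + 1) → ℤ) :
    floorForm t x = ∑ j, ⌊(Fin.cons 1 t : Fin (k + 1) → ℝ) j * (x j : ℝ)⌋ := by
  rw [Fin.sum_univ_succ]
  simp [floorForm]

theorem floorForm_mem_arithmeticSum {k : ℕ} {E : Fin (k + 1) → Set ℤ} (t : Fin k → ℝ)
    {x : Fin (k + 1) → ℤ} (hx : ∀ i, x i ∈ E i) : floorForm t x ∈ arithmeticSum E t :=
  Set.add_mem_add (hx 0) (Set.finsetSum_mem_finsetSum _ _ _ fun i _ =>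
    Set.mem_image_of_mem _ (hx i.succ))

theorem abs_floorForm_le {k : ℕ} {t : Fin k → ℝ} {R : ℝ} (hR : 0 ≤ R) (ht : t ∈ cube k R)
    {x : Fin (k + 1) → ℤ} {B : ℝ} (hx : ∀ i, |(x i : ℝ)| ≤ B) :
    |(floorForm t x : ℝ)| ≤ B + k * (R * B + 1) := by
  unfold floorForm
  push_cast
  refine (abs_add_le _ _).trans (add_le_add (hx 0) ?_)
  refine (Finset.abs_sum_le_sum_abs _ _).trans ?_
  calc _ ≤ ∑ _i : Fin k, (R * B + 1) := by
        refine Finset.sum_le_sum fun i _ => ?_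
        have h1 : |t i * (x i.succ : ℝ)| ≤ R * B := by
          rw [abs_mul]
          exact mul_le_mul (abs_le.2 (ht i trivial)) (hx _) (abs_nonneg _) hR
        have h2 := abs_le.1 h1
        have h3 := Int.floor_le (t i * (x i.succ : ℝ))
        have h4 := Int.lt_floor_add_one (t i * (x i.succ : ℝ))
        exact abs_le.2 ⟨by linarith, by linarith⟩
    _ = _ := by simp [mul_add]

theorem card_le_countIn {S : Set ℤ} {C D T : ℕ} {s : Finset ℤ} (hs : ∀ v ∈ s, v ∈ S)
    (hb : ∀ v ∈ s, |(v : ℝ)| < C * (T : ℝ) ^ D) : s.card ≤ countIn S (symmInterval C D T) := by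
  rw [← Set.ncard_coe_finset s]
  refine Set.ncard_le_ncard (fun v hv => ⟨hs v hv, ?_⟩)
    ((Set.finite_Ioc _ _).subset Set.inter_subset_right)
  have h : |(v : ℝ)| < ((C * T ^ D : ℕ) : ℝ) := by
    push_cast
    exact hb v hv
  have h' : |v| < ((C * T ^ D : ℕ) : ℤ) := by exact_mod_cast h
  have := abs_lt.1 h'
  simp only [symmInterval, Set.mem_Ioc]
  omega

/-! ### Passing from means to almost every parameter -/

/-- By Fatou's lemma, a sequence of nonnegative functions bounded in mean is almost everywhere
bounded along a subsequence, which depends on the point. -/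
theorem ae_exists_frequently_le_of_lintegral_le {α : Type*} [MeasurableSpace α] {μ : Measure α}
    {f : ℕ → α → ENNReal} (hf : ∀ n, Measurable (f n)) {K : ENNReal} (hK : K ≠ ⊤)
    (h : ∀ᶠ n in atTop, ∫⁻ x, f n x ∂μ ≤ K) :
    ∀ᵐ x ∂μ, ∃ C : ENNReal, C ≠ ⊤ ∧ ∃ᶠ n in atTop, f n x ≤ C := by
  have h1 : ∫⁻ x, liminf (fun n => f n x) atTop ∂μ ≠ ⊤ := by
    refine ne_top_of_le_ne_top hK ((lintegral_liminf_le hf).trans ?_)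
    exact liminf_le_of_frequently_le' h.frequently
  filter_upwards [ae_lt_top (Measurable.liminf hf) h1] with x hx
  obtain ⟨C, hC, hC'⟩ := exists_between hx
  exact ⟨C, hC'.ne, (frequently_lt_of_liminf_lt isCobounded_ge_of_top hC).mono fun _ h => h.le⟩

/-! ### Dyadic blocks of polynomial values -/

/-- The values of `p` on the natural numbers in `[L, 2L)`. -/
noncomputable def dyadicValues (p : Polynomial ℤ) (L : ℕ) : Finset ℤ :=
  (Finset.Ico L (2 * L)).image fun n : ℕ => p.eval (n : ℤ)

/-- The sets `p i ([T ^ e i, 2 T ^ e i))`, with `e i = D / deg (p i)`, all live at the scale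
`T ^ D` and have gaps `≫ T ^ (D - e i)`. Using powers of an integer `T` keeps all exponents natural. -/
theorem exists_dyadicValues_bounds {ι : Type*} [Finite ι] (p : ι → Polynomial ℤ) {e : ι → ℕ} {D : ℕ}
    (hD : 0 < D) (he : ∀ i, (p i).natDegree * e i = D) :
    ∃ C : ℝ, 1 ≤ C ∧ ∀ᶠ T : ℕ in atTop, ∀ i, (dyadicValues (p i) (T ^ e i)).card = T ^ e i ∧
      (∀ x ∈ dyadicValues (p i) (T ^ e i), ∀ y ∈ dyadicValues (p i) (T ^ e i), x ≠ y →
        (T : ℝ) ^ (D - e i) / C ≤ |(x : ℝ) - y|) ∧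
      ∀ x ∈ dyadicValues (p i) (T ^ e i), |(x : ℝ)| ≤ C * (T : ℝ) ^ D := by
  have := Fintype.ofFinite ι
  have hd1 : ∀ i, 1 ≤ (p i).natDegree := fun i => Nat.pos_of_ne_zero fun h => by
    have := he i
    rw [h] at this
    omega
  have he1 : ∀ i, e i ≠ 0 := fun i h => by
    have := he i
    rw [h] at this
    omega
  choose c hc1 hc using fun i => (p i).exists_separated_of_natDegree (hd1 i)
  have hcC : ∀ i, c i ≤ 1 + ∑ j, c j := fun i => by
    have := Finset.single_le_sum (f := c) (fun j _ => by linarith [hc1 j]) (Finset.mem_univ i)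
    linarith
  refine ⟨1 + ∑ j, c j, by
    have := Finset.sum_nonneg fun j (_ : j ∈ Finset.univ) => (by linarith [hc1 j] : 0 ≤ c j)
    linarith, ?_⟩
  rw [eventually_all]
  intro i
  filter_upwards [(tendsto_pow_atTop (α := ℕ) (he1 i)).eventually (hc i),
    eventually_gt_atTop 0] with T hT hT0
  have hT0' : (0 : ℝ) < T := by exact_mod_cast hT0
  have hC0 : (0 : ℝ) < 1 + ∑ j, c j := by linarith [hc1 i, hcC i]
  have hpow : ((T ^ e i : ℕ) : ℝ) ^ ((p i).natDegree - 1) = (T : ℝ) ^ (D - e i) := by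
    rw [Nat.cast_pow, ← pow_mul, mul_comm, Nat.sub_mul, one_mul, he i]
  have hpow' : ((T ^ e i : ℕ) : ℝ) ^ (p i).natDegree = (T : ℝ) ^ D := by
    rw [Nat.cast_pow, ← pow_mul, mul_comm, he i]
  simp only [hpow, hpow'] at hT
  have hsep : ∀ n ∈ Finset.Ico (T ^ e i) (2 * T ^ e i), ∀ m ∈ Finset.Ico (T ^ e i) (2 * T ^ e i),
      n ≠ m → (T : ℝ) ^ (D - e i) / (1 + ∑ j, c j) ≤
        |(((p i).eval (n : ℤ) : ℤ) : ℝ) - (p i).eval (m : ℤ)| := by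
    intro n hn m hm hnm
    rw [div_le_iff₀' hC0]
    have h1 : (1 : ℝ) ≤ |(n : ℝ) - m| := by
      have : (1 : ℤ) ≤ |(n : ℤ) - m| := Int.one_le_abs (by omega)
      exact_mod_cast this
    calc (T : ℝ) ^ (D - e i) ≤ (T : ℝ) ^ (D - e i) * |(n : ℝ) - m| :=
          le_mul_of_one_le_right (by positivity) h1
      _ ≤ _ := (hT n hn m hm).1
      _ ≤ _ := by gcongr; exact hcC i
  refine ⟨?_, ?_, ?_⟩
  · rw [dyadicValues, Finset.card_image_of_injOn, Nat.card_Ico]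
    · omega
    · intro n hn m hm h
      by_contra hnm
      have h1 := hsep n hn m hm hnm
      simp only at h
      rw [h, sub_self, abs_zero] at h1
      exact absurd h1 (not_le.2 (by positivity))
  · intro x hx y hy hxy
    simp only [dyadicValues, Finset.mem_image] at hx hy
    obtain ⟨n, hn, rfl⟩ := hx
    obtain ⟨m, hm, rfl⟩ := hy
    exact hsep n hn m hm fun h => hxy (by rw [h])
  · intro x hx
    simp only [dyadicValues, Finset.mem_image] at hx
    obtain ⟨n, hn, rfl⟩ := hx
    refine (hT n hn n hn).2.trans ?_
    gcongr
    exact hcC i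

/-- The energy estimate for the product of the dyadic value sets, whose cardinality is `T ^ ∑ e
i`. The degrees have to be at least two: for a linear polynomial the single-coordinate
contribution is logarithmic in `T`. -/
theorem exists_sum_inv_norm_dyadicValues_le {ι : Type*} [Fintype ι] [DecidableEq ι]
    (p : ι → Polynomial ℤ) {e : ι → ℕ} {D : ℕ} (hD : 0 < D)
    (he : ∀ i, (p i).natDegree * e i = D) (hdeg : ∀ i, 2 ≤ (p i).natDegree) :
    ∃ C : ℝ, 1 ≤ C ∧ ∀ᶠ T : ℕ in atTop,
      (Fintype.piFinset fun i => dyadicValues (p i) (T ^ e i)).card = T ^ ∑ i, e i ∧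
      ∀ x ∈ Fintype.piFinset fun i => dyadicValues (p i) (T ^ e i),
        (∀ i, |(x i : ℝ)| ≤ C * (T : ℝ) ^ D) ∧
        ∑ y ∈ (Fintype.piFinset fun i => dyadicValues (p i) (T ^ e i)).erase x, ‖x - y‖⁻¹ ≤
          C * (1 + (T : ℝ) ^ (∑ i, e i) / (T : ℝ) ^ D) := by
  obtain ⟨C, hC, hev⟩ := exists_dyadicValues_bounds p hD he
  have hC0 : 0 < C := by linarith
  set n := Fintype.card ι
  set M : ℝ := n * (2 ^ n * (C + (3 * C ^ 2) ^ n)) with hM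
  have hM0 : 0 ≤ M := by positivity
  refine ⟨C + M, by linarith, ?_⟩
  filter_upwards [hev, eventually_ge_atTop 1] with T hT hT1
  have hT1' : (1 : ℝ) ≤ T := by exact_mod_cast hT1
  have hT0 : (0 : ℝ) < T := by linarith
  refine ⟨?_, fun x hx => ⟨fun i => ?_, ?_⟩⟩
  · rw [Fintype.card_piFinset, ← Finset.prod_pow_eq_pow_sum]
    exact Finset.prod_congr rfl fun i _ => (hT i).1
  · refine ((hT i).2.2 _ (Fintype.mem_piFinset.1 hx i)).trans ?_
    gcongr
    linarith
  · refine (sum_inv_norm_sub_le (δ := fun i => (T : ℝ) ^ (D - e i) / C) (B := 2 * C * (T : ℝ) ^ D)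
      (fun i => by positivity) (fun i => (hT i).2.1) (by positivity) (fun i x hx y hy => ?_)
      hx).trans ?_
    · have h1 := (hT i).2.2 x hx
      have h2 := (hT i).2.2 y hy
      have := abs_sub (x : ℝ) y
      linarith
    have hterm : ∀ i, ((dyadicValues (p i) (T ^ e i)).card : ℝ) * (2 ^ n *
        (((T : ℝ) ^ (D - e i) / C)⁻¹ + (2 * C * (T : ℝ) ^ D)⁻¹ * ∏ j ∈ Finset.univ.erase i,
          (1 + 2 * C * (T : ℝ) ^ D / ((T : ℝ) ^ (D - e j) / C)))) ≤
        2 ^ n * (C + (3 * C ^ 2) ^ n) * (1 + (T : ℝ) ^ (∑ i, e i) / (T : ℝ) ^ D) := by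
      intro i
      rw [(hT i).1, Nat.cast_pow]
      have hed : ∀ j, e j ≤ D - e j := fun j => by
        have h1 := he j
        have h2 := Nat.mul_le_mul_right (e j) (hdeg j)
        omega
      -- a single varying coordinate contributes `O(1)` because `e i ≤ D / 2`
      have h1 : (T : ℝ) ^ e i * ((T : ℝ) ^ (D - e i) / C)⁻¹ ≤ C := by
        rw [inv_div, ← mul_div_assoc, div_le_iff₀ (by positivity), mul_comm]
        gcongr
        exact hed i
      have h2 : ∏ j ∈ Finset.univ.erase i, (1 + 2 * C * (T : ℝ) ^ D / ((T : ℝ) ^ (D - e j) / C)) ≤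
          (3 * C ^ 2) ^ n * ∏ j ∈ Finset.univ.erase i, (T : ℝ) ^ e j := by
        calc _ ≤ ∏ j ∈ Finset.univ.erase i, (3 * C ^ 2 * (T : ℝ) ^ e j) := by
              refine Finset.prod_le_prod (fun j _ => by positivity) fun j _ => ?_
              have h3 : (T : ℝ) ^ D = (T : ℝ) ^ (D - e j) * (T : ℝ) ^ e j := by
                rw [← pow_add]
                congr 1
                have := hed j
                omega
              have h4 : 2 * C * (T : ℝ) ^ D / ((T : ℝ) ^ (D - e j) / C) =
                  2 * C ^ 2 * (T : ℝ) ^ e j := by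
                rw [h3]
                field_simp
              rw [h4]
              have h5 : 1 ≤ C ^ 2 * (T : ℝ) ^ e j :=
                one_le_mul_of_one_le_of_one_le (one_le_pow₀ hC) (one_le_pow₀ hT1')
              linarith
          _ = (3 * C ^ 2) ^ (Finset.univ.erase i).card *
                ∏ j ∈ Finset.univ.erase i, (T : ℝ) ^ e j := by
              rw [Finset.prod_mul_distrib, Finset.prod_const]
          _ ≤ _ := by
              gcongr
              · nlinarith
              · exact Finset.card_le_univ _
      have h3 : (T : ℝ) ^ e i * ∏ j ∈ Finset.univ.erase i, (T : ℝ) ^ e j =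
          (T : ℝ) ^ ∑ i, e i := by
        rw [Finset.mul_prod_erase _ (fun j => (T : ℝ) ^ e j) (Finset.mem_univ i),
          Finset.prod_pow_eq_pow_sum]
      have h4 : (2 * C * (T : ℝ) ^ D)⁻¹ ≤ ((T : ℝ) ^ D)⁻¹ := by
        refine inv_anti₀ (by positivity) ?_
        have : 0 < (T : ℝ) ^ D := by positivity
        nlinarith
      have h5 : (T : ℝ) ^ e i * ((2 * C * (T : ℝ) ^ D)⁻¹ * ∏ j ∈ Finset.univ.erase i,
          (1 + 2 * C * (T : ℝ) ^ D / ((T : ℝ) ^ (D - e j) / C))) ≤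
          (3 * C ^ 2) ^ n * ((T : ℝ) ^ (∑ i, e i) / (T : ℝ) ^ D) := by
        calc _ ≤ (T : ℝ) ^ e i * (((T : ℝ) ^ D)⁻¹ *
              ((3 * C ^ 2) ^ n * ∏ j ∈ Finset.univ.erase i, (T : ℝ) ^ e j)) := by
              gcongr
          _ = _ := by
              rw [← h3]
              field_simp
      have h6 : 0 ≤ (T : ℝ) ^ (∑ i, e i) / (T : ℝ) ^ D := by positivity
      have h7 : 0 ≤ (3 * C ^ 2) ^ n := by positivity
      rw [mul_left_comm, mul_assoc (2 ^ n)]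
      refine mul_le_mul_of_nonneg_left ?_ (by positivity)
      nlinarith [mul_nonneg hC0.le h6]
    refine (Finset.sum_le_sum fun i _ => hterm i).trans ?_
    rw [Finset.sum_const, nsmul_eq_mul, Finset.card_univ, ← mul_assoc]
    change M * _ ≤ _
    gcongr
    linarith

/-- For almost every `t` in a cube, the number of collisions is infinitely often at most a
constant times its mean `P (1 + P / N)`, where `P = T ^ ∑ e i` and `N = T ^ D`. Cauchy–Schwarz
then gives `≫ min (P, N)` distinct values of `floorForm t`, all of them of size `≪ N`. -/
theorem ae_cube_frequently_countIn_ge {k : ℕ} (p : Fin (k + 1) → Polynomial ℤ)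
    {e : Fin (k + 1) → ℕ} {D : ℕ} (hD : 0 < D) (he : ∀ i, (p i).natDegree * e i = D)
    (hdeg : ∀ i, 2 ≤ (p i).natDegree) {R : ℝ} (hR : 0 < R) :
    ∀ᵐ t ∂volume.restrict (cube k R), ∃ c : ℝ, 0 < c ∧ ∃ C : ℕ, 0 < C ∧ ∃ᶠ T : ℕ in atTop,
      c * (T : ℝ) ^ min (∑ i, e i) D ≤
        countIn (arithmeticSum (fun i => polySet (p i)) t) (symmInterval C D T) := by
  obtain ⟨C, hC, hev⟩ := exists_sum_inv_norm_dyadicValues_le p hD he hdeg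
  obtain ⟨K, hK, hint⟩ := lintegral_collisions_le k hR
  have hC0 : 0 < C := by linarith
  set X : ℕ → Finset (Fin (k + 1) → ℤ) := fun T =>
    Fintype.piFinset fun i => dyadicValues (p i) (T ^ e i) with hX
  set s := ∑ i, e i with hs
  -- the expected order of magnitude of the number of collisions
  set Q : ℕ → ℝ := fun T => (T : ℝ) ^ s * (1 + (T : ℝ) ^ s / (T : ℝ) ^ D) with hQ
  have hQ0 : ∀ T : ℕ, 0 < T → 0 < Q T := fun T hT => by
    have : (0 : ℝ) < T := by exact_mod_cast hT
    positivity
  have hbound : ∀ᶠ T : ℕ in atTop, ∫⁻ t in cube k R,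
      (collisions (X T) t : ENNReal) / ENNReal.ofReal (Q T) ≤ ENNReal.ofReal (K * (1 + C)) := by
    filter_upwards [hev, eventually_gt_atTop 0] with T hT hT0
    have hT0' : (0 : ℝ) < T := by exact_mod_cast hT0
    simp only [div_eq_mul_inv]
    rw [lintegral_mul_const _ (measurable_collisions _), ← div_eq_mul_inv]
    refine ENNReal.div_le_of_le_mul ?_
    refine (hint (X T) (C * (1 + (T : ℝ) ^ s / (T : ℝ) ^ D)) (by positivity)
      fun x hx => (hT.2 x hx).2).trans ?_
    rw [← ENNReal.ofReal_mul (by positivity)]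
    refine ENNReal.ofReal_le_ofReal ?_
    rw [hT.1, hQ]
    push_cast
    have h1 : 0 ≤ (T : ℝ) ^ s / (T : ℝ) ^ D := by positivity
    calc K * (T : ℝ) ^ s * (1 + C * (1 + (T : ℝ) ^ s / (T : ℝ) ^ D)) ≤
        K * (T : ℝ) ^ s * ((1 + C) * (1 + (T : ℝ) ^ s / (T : ℝ) ^ D)) := by
          gcongr
          linarith
      _ = _ := by ring
  have hae := ae_exists_frequently_le_of_lintegral_le (μ := volume.restrict (cube k R))
    (fun T => (measurable_collisions (X T)).div_const (ENNReal.ofReal (Q T)))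
    ENNReal.ofReal_ne_top hbound
  filter_upwards [hae, ae_restrict_mem (measurableSet_cube k R)] with t ⟨M, hM, hfreq⟩ htR
  set m : ℝ := M.toReal + 1 with hm
  have hm0 : 0 < m := by positivity
  set C' : ℝ := C + k * (R * C + 1) with hC'
  refine ⟨(2 * m)⁻¹, by positivity, ⌊C'⌋₊ + 1, by omega, ?_⟩
  refine (hfreq.and_eventually (hev.and (eventually_ge_atTop 1))).mono ?_
  rintro T ⟨hcol, ⟨hcard, hT⟩, hT1⟩
  have hT1' : (1 : ℝ) ≤ T := by exact_mod_cast hT1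
  have hT0' : (0 : ℝ) < T := by linarith
  have hcol' : (collisions (X T) t : ℝ) ≤ m * Q T := by
    have hQT := hQ0 T hT1
    rw [ENNReal.div_le_iff (by simpa using hQT) ENNReal.ofReal_ne_top] at hcol
    have := ENNReal.toReal_mono (ENNReal.mul_ne_top hM ENNReal.ofReal_ne_top) hcol
    rw [ENNReal.toReal_natCast, ENNReal.toReal_mul, ENNReal.toReal_ofReal hQT.le] at this
    nlinarith
  have hCS : ((X T).card : ℝ) ^ 2 ≤ ((X T).image (floorForm t)).card * collisions (X T) t := by
    exact_mod_cast card_sq_le_card_image_mul_energy (X T) (floorForm t)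
  have himage : ((X T).image (floorForm t)).card ≤
      countIn (arithmeticSum (fun i => polySet (p i)) t) (symmInterval (⌊C'⌋₊ + 1) D T) := by
    refine card_le_countIn (fun v hv => ?_) fun v hv => ?_
    · obtain ⟨x, hx, rfl⟩ := Finset.mem_image.1 hv
      refine floorForm_mem_arithmeticSum t fun i => ?_
      have := Fintype.mem_piFinset.1 hx i
      simp only [dyadicValues, Finset.mem_image] at this
      obtain ⟨n, -, hn⟩ := this
      exact ⟨n, hn⟩
    · obtain ⟨x, hx, rfl⟩ := Finset.mem_image.1 hv
      have hTD : 1 ≤ (T : ℝ) ^ D := one_le_pow₀ hT1'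
      calc |(floorForm t x : ℝ)| ≤ C * (T : ℝ) ^ D + k * (R * (C * (T : ℝ) ^ D) + 1) :=
            abs_floorForm_le hR.le htR (hT x hx).1
        _ ≤ C * (T : ℝ) ^ D + k * (R * (C * (T : ℝ) ^ D) + (T : ℝ) ^ D) := by gcongr
        _ = C' * (T : ℝ) ^ D := by rw [hC']; ring
        _ < _ := by
          push_cast
          gcongr
          exact Nat.lt_floor_add_one _
  have hq : (T : ℝ) ^ min s D * (1 + (T : ℝ) ^ s / (T : ℝ) ^ D) ≤ 2 * (T : ℝ) ^ s := by
    have h1 : (T : ℝ) ^ min s D ≤ (T : ℝ) ^ s := pow_le_pow_right₀ hT1' (min_le_left _ _)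
    have h2 : (T : ℝ) ^ min s D ≤ (T : ℝ) ^ D := pow_le_pow_right₀ hT1' (min_le_right _ _)
    have h3 : (T : ℝ) ^ min s D * ((T : ℝ) ^ s / (T : ℝ) ^ D) ≤ (T : ℝ) ^ s := by
      rw [mul_div_assoc', div_le_iff₀ (by positivity), mul_comm]
      gcongr
    linarith
  have himage' : (((X T).image (floorForm t)).card : ℝ) ≤
      countIn (arithmeticSum (fun i => polySet (p i)) t) (symmInterval (⌊C'⌋₊ + 1) D T) := by
    exact_mod_cast himage
  refine le_trans ?_ himage'
  rw [hcard] at hCS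
  push_cast at hCS
  set I : ℝ := (((X T).image (floorForm t)).card : ℝ) with hI
  have hI0 : 0 ≤ I := by positivity
  set w : ℝ := 1 + (T : ℝ) ^ s / (T : ℝ) ^ D with hw
  have hw0 : 0 < w := by positivity
  have hs0 : 0 < (T : ℝ) ^ s := by positivity
  -- Cauchy-Schwarz, after cancelling one factor `T ^ s`
  have h1 : (T : ℝ) ^ s ≤ I * (m * w) := by
    have h2 : (T : ℝ) ^ s * (T : ℝ) ^ s ≤ I * (m * w) * (T : ℝ) ^ s := by
      calc (T : ℝ) ^ s * (T : ℝ) ^ s = ((T : ℝ) ^ s) ^ 2 := by ring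
        _ ≤ I * collisions (X T) t := hCS
        _ ≤ I * (m * Q T) := by gcongr
        _ = _ := by rw [hQ]; ring
    exact le_of_mul_le_mul_right h2 hs0
  rw [inv_mul_le_iff₀ (by positivity)]
  refine le_of_mul_le_mul_right ?_ hw0
  calc _ ≤ 2 * (T : ℝ) ^ s := hq
    _ ≤ 2 * (I * (m * w)) := by gcongr
    _ = _ := by ring

/-! ### The linear case -/

/-- If one of the polynomials is linear, the arithmetic sum contains a translate of the floors of
a nonconstant arithmetic progression, obtained by freezing the other variables. -/
theorem exists_countIn_ge_of_linear {k : ℕ} (p : Fin (k + 1) → Polynomial ℤ)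
    {i : Fin (k + 1)} (hi : (p i).natDegree = 1) {t : Fin k → ℝ} (ht : ∀ j, t j ≠ 0) :
    ∃ C : ℕ, 0 < C ∧ ∀ᶠ T : ℕ in atTop,
      1 * (T : ℝ) ^ 1 ≤
        countIn (arithmeticSum (fun i => polySet (p i)) t) (symmInterval C 1 T) := by
  obtain ⟨a, b, hab⟩ := Polynomial.exists_eq_X_add_C_of_natDegree_le_one hi.le
  have ha : a ≠ 0 := by
    rintro rfl
    rw [hab] at hi
    simp at hi
  set τ : ℝ := (Fin.cons 1 t : Fin (k + 1) → ℝ) i with hτ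
  have hτ0 : τ ≠ 0 := by
    rw [hτ]
    refine Fin.cases ?_ (fun j => ?_) i
    · simp
    · simpa using ht j
  have hτa : 0 < |τ * a| := abs_pos.2 (mul_ne_zero hτ0 (by exact_mod_cast ha))
  -- along multiples of `q` the dilated progression has steps of size at least one
  obtain ⟨q, hq⟩ := exists_nat_ge (|τ * a|⁻¹)
  set u : ℝ := τ * a * q with hu
  have hu1 : 1 ≤ |u| := by
    rw [hu, abs_mul, Nat.abs_cast]
    calc 1 = |τ * a| * |τ * a|⁻¹ := (mul_inv_cancel₀ hτa.ne').symm
      _ ≤ _ := by gcongr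
  set v : ℝ := τ * b with hv
  set r : ℤ := ∑ j ∈ Finset.univ.erase i,
    ⌊(Fin.cons 1 t : Fin (k + 1) → ℝ) j * (((p j).eval 0 : ℤ) : ℝ)⌋ with hr
  have hmem : ∀ n : ℕ, ⌊u * n + v⌋ + r ∈ arithmeticSum (fun i => polySet (p i)) t := by
    intro n
    set x : Fin (k + 1) → ℤ := fun j => if j = i then (p i).eval ((q * n : ℕ) : ℤ)
      else (p j).eval 0 with hx
    have hxmem : floorForm t x ∈ arithmeticSum (fun i => polySet (p i)) t := by
      refine floorForm_mem_arithmeticSum t fun j => ?_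
      by_cases hj : j = i
      · subst hj
        simp only [hx, if_true]
        exact ⟨_, rfl⟩
      · simp only [hx, if_neg hj]
        exact ⟨_, rfl⟩
    convert hxmem using 1
    rw [floorForm_eq_sum, ← Finset.add_sum_erase _ _ (Finset.mem_univ i)]
    congr 1
    · congr 1
      simp only [hx, if_true]
      rw [hab, hu, hv, hτ]
      simp
      ring
    · refine Finset.sum_congr rfl fun j hj => ?_
      simp only [hx, if_neg (Finset.ne_of_mem_erase hj)]
  set C : ℝ := |u| + |v| + 1 + |(r : ℝ)| with hC
  refine ⟨⌊C⌋₊ + 1, by omega, ?_⟩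
  filter_upwards [eventually_ge_atTop 1] with T hT1
  have hT1' : (1 : ℝ) ≤ T := by exact_mod_cast hT1
  have hcard : ((Finset.range T).image fun n : ℕ => ⌊u * n + v⌋ + r).card = T := by
    rw [Finset.card_image_of_injective, Finset.card_range]
    intro n m hnm
    have h1 := Int.abs_sub_lt_one_of_floor_eq_floor (add_right_cancel hnm)
    have h2 : u * n + v - (u * m + v) = u * (n - m) := by ring
    rw [h2, abs_mul] at h1
    by_contra hne
    have h3 : (1 : ℝ) ≤ |(n : ℝ) - m| := by
      have : (1 : ℤ) ≤ |(n : ℤ) - m| := Int.one_le_abs (by omega)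
      exact_mod_cast this
    nlinarith
  have h := card_le_countIn (S := arithmeticSum (fun i => polySet (p i)) t) (C := ⌊C⌋₊ + 1)
    (D := 1) (T := T) (s := (Finset.range T).image fun n : ℕ => ⌊u * n + v⌋ + r)
    (fun w hw => by
      obtain ⟨n, -, rfl⟩ := Finset.mem_image.1 hw
      exact hmem n)
    (fun w hw => by
      obtain ⟨n, hn, rfl⟩ := Finset.mem_image.1 hw
      have hnT : (n : ℝ) ≤ T := by exact_mod_cast (Finset.mem_range.1 hn).le
      have h1 : |u * n| ≤ |u| * T := by
        rw [abs_mul, Nat.abs_cast]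
        gcongr
      have h2 : |(⌊u * n + v⌋ : ℝ)| ≤ |u| * T + |v| + 1 := by
        have h3 := Int.floor_le (u * n + v)
        have h4 := Int.lt_floor_add_one (u * n + v)
        have h5 := abs_le.1 h1
        have h6 := abs_le.1 (le_refl |v|)
        exact abs_le.2 ⟨by linarith, by linarith⟩
      push_cast
      rw [pow_one]
      calc |(⌊u * n + v⌋ : ℝ) + r| ≤ |u| * T + |v| + 1 + |(r : ℝ)| :=
            (abs_add_le _ _).trans (by gcongr)
        _ ≤ C * T := by
            have h7 : (|v| + 1 + |(r : ℝ)|) * 1 ≤ (|v| + 1 + |(r : ℝ)|) * T := by gcongr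
            rw [hC]
            linarith
        _ < _ := by
            gcongr
            exact Nat.lt_floor_add_one _)
  rw [hcard] at h
  rw [one_mul, pow_one]
  exact_mod_cast h

/-! ### Almost every parameter -/

theorem ae_forall_coord_ne_zero (k : ℕ) : ∀ᵐ t : Fin k → ℝ, ∀ j, t j ≠ 0 := by
  rw [ae_all_iff]
  intro j
  have h := Measure.pi_hyperplane (fun _ : Fin k => (volume : Measure ℝ)) j 0
  rw [← volume_pi] at h
  exact measure_eq_zero_iff_ae_notMem.1 h

theorem exists_mem_cube {k : ℕ} (t : Fin k → ℝ) : ∃ n : ℕ, t ∈ cube k (n + 1) := by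
  obtain ⟨n, hn⟩ := exists_nat_ge ‖t‖
  refine ⟨n, fun i _ => ?_⟩
  have := norm_le_pi_norm t i
  rw [Real.norm_eq_abs] at this
  exact abs_le.1 (by linarith)

theorem ae_frequently_countIn_ge {k : ℕ} (p : Fin (k + 1) → Polynomial ℤ)
    {e : Fin (k + 1) → ℕ} {D : ℕ} (hD : 0 < D) (he : ∀ i, (p i).natDegree * e i = D)
    (hdeg : ∀ i, 2 ≤ (p i).natDegree) :
    ∀ᵐ t : Fin k → ℝ, ∃ c : ℝ, 0 < c ∧ ∃ C : ℕ, 0 < C ∧ ∃ᶠ T : ℕ in atTop,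
      c * (T : ℝ) ^ min (∑ i, e i) D ≤
        countIn (arithmeticSum (fun i => polySet (p i)) t) (symmInterval C D T) := by
  have h : ∀ n : ℕ, _ := fun n =>
    (ae_restrict_iff' (measurableSet_cube k (n + 1))).1
      (ae_cube_frequently_countIn_ge p hD he hdeg (R := n + 1) (by positivity))
  filter_upwards [ae_all_iff.2 h] with t ht
  obtain ⟨n, hn⟩ := exists_mem_cube t
  exact ht n hn

theorem theorem1p2 (k : ℕ) (p : Fin (k + 1) → Polynomial ℤ) (d : Fin (k + 1) → ℕ)
    (hdeg : ∀ i, (p i).natDegree = d i) (hpos : ∀ i, 1 ≤ d i) :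
    (∀ᵐ t : Fin k → ℝ ∂MeasureTheory.volume,
        min 1 (∑ i, 1 / (d i : ℝ)) ≤ countingDimension (arithmeticSum (fun i => polySet (p i)) t)) ∧
      (1 < ∑ i, 1 / (d i : ℝ) →
        ∀ᵐ t : Fin k → ℝ ∂MeasureTheory.volume,
          0 < upperBanachDensity (arithmeticSum (fun i => polySet (p i)) t)) := by
  by_cases hlin : ∃ i, d i = 1
  · obtain ⟨i, hi⟩ := hlin
    rw [← hdeg i] at hi
    constructor
    · filter_upwards [ae_forall_coord_ne_zero k] with t ht
      obtain ⟨C, hC, h⟩ := exists_countIn_ge_of_linear p hi ht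
      have := countingDimension_ge_of_frequently one_pos hC one_pos h.frequently
      refine (min_le_left _ _).trans ?_
      simpa using this
    · intro _
      filter_upwards [ae_forall_coord_ne_zero k] with t ht
      obtain ⟨C, hC, h⟩ := exists_countIn_ge_of_linear p hi ht
      exact upperBanachDensity_pos_of_frequently one_pos hC one_pos h.frequently
  · push Not at hlin
    have hd2 : ∀ i, 2 ≤ (p i).natDegree := fun i => by
      have h1 := hpos i
      have h2 := hlin i
      rw [hdeg i]
      omega
    set D := ∏ i, d i with hD
    have hD0 : 0 < D := Finset.prod_pos fun i _ => hpos i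
    have hD0' : (0 : ℝ) < D := by exact_mod_cast hD0
    set e : Fin (k + 1) → ℕ := fun i => D / d i with he
    have hde : ∀ i, d i * e i = D := fun i =>
      Nat.mul_div_cancel' (Finset.dvd_prod_of_mem d (Finset.mem_univ i))
    have hde' : ∀ i, (p i).natDegree * e i = D := fun i => by rw [hdeg i, hde i]
    have hsum : ∑ i, 1 / (d i : ℝ) = ((∑ i, e i : ℕ) : ℝ) / D := by
      rw [Nat.cast_sum, Finset.sum_div]
      refine Finset.sum_congr rfl fun i _ => ?_
      have h1 : (0 : ℝ) < d i := by exact_mod_cast hpos i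
      rw [div_eq_div_iff h1.ne' hD0'.ne', one_mul, mul_comm]
      exact_mod_cast (hde i).symm
    have hae := ae_frequently_countIn_ge p hD0 hde' hd2
    constructor
    · filter_upwards [hae] with t ⟨c, hc, C, hC, h⟩
      refine le_trans (le_of_eq ?_) (countingDimension_ge_of_frequently hc hC hD0 h)
      rw [hsum, Nat.cast_min, ← min_div_div_right hD0'.le, div_self hD0'.ne', min_comm]
    · intro hgt
      rw [hsum, one_lt_div hD0', Nat.cast_lt] at hgt
      filter_upwards [hae] with t ⟨c, hc, C, hC, h⟩
      rw [min_eq_right hgt.le] at h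
      exact upperBanachDensity_pos_of_frequently hc hC hD0 h
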